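/- Let $K$ be a field with a discrete non-Archimedean valuation $v : K \to \mathbb{Z}\cup\{\infty\}$ whose value group is $\mathbb{Z}$, and assume that $(K,v)$ is henselian. Let $\phi \in K[z]$ be a polynomial of degree three. A periodic point $z \in K$ of $\phi$ of exact period $n \ge 1$ is called repelling if $v\big((\phi^{n})'(z)\big) < 0$, where $\phi^{n}$ denotes the $n$-fold composite of $\phi$ with itself; in particular, a fixed point $z$ of $\phi$ is repelling if and only if $v(\phi'(z)) < 0$. If no fixed point of $\phi$ in $K$ is repelling, then no periodic point of $\phi$ in $K$ is repelling. -/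

import Mathlib

open Polynomial
open scoped WithZero

namespace PolyDynamics

/-- The self-map `z ↦ φ(z)` of `K` induced by a polynomial `φ`. -/
def toMap {K : Type*} [Field K] (φ : K[X]) : K → K := fun z => φ.eval z

/-- The multiplier `(φⁿ)'(z)` of a periodic point `z` of exact period `n`, where `φⁿ` is the
`n`-fold composite of the polynomial `φ`; for a fixed point this is `φ'(z)`. -/
noncomputable def multiplier {K : Type*} [Field K] (φ : K[X]) (z : K) : K :=
  (derivative (φ.comp^[Function.minimalPeriod (toMap φ) z] X)).eval z

/-- `z` is a repelling periodic point of `φ`: it is periodic and its multiplier has absolute value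
greater than `1`. Here `v` is written multiplicatively, so this says that the additive valuation
of the multiplier is negative. -/
def IsRepelling {K : Type*} [Field K] (v : Valuation K ℤᵐ⁰) (φ : K[X]) (z : K) : Prop :=
  z ∈ Function.periodicPts (toMap φ) ∧ 1 < v (multiplier φ z)

end PolyDynamics

open scoped NNReal

namespace PolyDynamics

section Iterates

variable {K : Type*} [Field K] (φ : K[X])

theorem eval_iterate_comp (n : ℕ) (z : K) :
    (φ.comp^[n] X).eval z = (toMap φ)^[n] z := by
  induction n with
  | zero => simp
  | succ n ih => rw [Function.iterate_succ_apply', Function.iterate_succ_apply', eval_comp, ih]; rfl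

theorem eval_derivative_iterate_comp (n : ℕ) (z : K) :
    (derivative (φ.comp^[n] X)).eval z =
      ∏ i ∈ Finset.range n, φ.derivative.eval ((toMap φ)^[i] z) := by
  induction n with
  | zero => simp
  | succ n ih =>
    rw [Function.iterate_succ_apply', derivative_comp, eval_mul, eval_comp, eval_iterate_comp, ih,
      Finset.prod_range_succ, mul_comm]

theorem multiplier_of_isFixedPt {z : K} (hz : Function.IsFixedPt (toMap φ) z) :
    multiplier φ z = φ.derivative.eval z := by
  rw [multiplier, Function.minimalPeriod_eq_one_iff_isFixedPt.2 hz, eval_derivative_iterate_comp]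
  simp

/-- A cubic polynomial map minus the identity, expanded around a point `z`. -/
theorem exists_expansion (hφ : φ.natDegree = 3) (z : K) : ∃ a b c d : K, a ≠ 0 ∧
    (∀ h, toMap φ (z + h) = z + (h + (a * h ^ 3 + b * h ^ 2 + c * h + d))) ∧
    ∀ h, φ.derivative.eval (z + h) = 1 + (3 * a * h ^ 2 + 2 * b * h + c) := by
  have hs : φ = C (φ.coeff 0) + C (φ.coeff 1) * X + C (φ.coeff 2) * X ^ 2
      + C (φ.coeff 3) * X ^ 3 := by
    conv_lhs => rw [φ.as_sum_range_C_mul_X_pow, hφ]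
    simp [Finset.sum_range_succ]
  have ha : φ.coeff 3 ≠ 0 := by
    rw [← hφ]
    exact leadingCoeff_ne_zero.2 (fun h => by simp [h] at hφ)
  generalize φ.coeff 0 = s, φ.coeff 1 = r, φ.coeff 2 = q, φ.coeff 3 = p at hs ha
  subst hs
  refine ⟨p, 3 * p * z + q, 3 * p * z ^ 2 + 2 * q * z + r - 1,
    p * z ^ 3 + q * z ^ 2 + r * z + s - z, ha, fun h => ?_, fun h => ?_⟩
  · simp only [toMap, eval_add, eval_mul, eval_C, eval_X, eval_pow]
    ring
  · simp only [derivative_add, derivative_mul, derivative_C, derivative_X, derivative_X_pow,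
      eval_add, eval_mul, eval_C, eval_X, eval_pow, eval_zero, eval_one]
    push_cast
    ring

end Iterates

section Hensel

variable {K Γ₀ : Type*} [Field K] [LinearOrderedCommGroupWithZero Γ₀] (v : Valuation K Γ₀)

theorem map_ofNat_le_one (n : ℕ) : v (n : K) ≤ 1 := by
  induction n with
  | zero => simp
  | succ n ih => push_cast; exact v.map_add_le ih (by simp)

/-- Hensel's lemma for the simple root `-1` of `u³ + u² = u² (u + 1)` over the residue field. -/
theorem exists_root_near_neg_one (hK : HenselianLocalRing v.valuationSubring) {β γ : K}
    (hβ : v β < 1) (hγ : v γ < 1) :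
    ∃ u : K, v u = 1 ∧ v (u + 1) < 1 ∧ u ^ 3 + u ^ 2 + β * u + γ = 0 := by
  have mem_max (x : v.valuationSubring) :
      x ∈ IsLocalRing.maximalIdeal v.valuationSubring ↔ v (x : K) < 1 := by
    rw [IsLocalRing.mem_maximalIdeal, mem_nonunits_iff]
    exact Valuation.Integer.not_isUnit_iff_valuation_lt_one
  let β' : v.valuationSubring := ⟨β, hβ.le⟩
  let γ' : v.valuationSubring := ⟨γ, hγ.le⟩
  let f : v.valuationSubring[X] := X ^ 3 + X ^ 2 + C β' * X + C γ'
  have hf : f.Monic := by simp only [f]; monicity!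
  have hf0 : f.eval (-1) ∈ IsLocalRing.maximalIdeal v.valuationSubring := by
    rw [show f.eval (-1) = γ' - β' by simp [f]; ring]
    exact sub_mem ((mem_max _).2 hγ) ((mem_max _).2 hβ)
  have hf1 : IsUnit (f.derivative.eval (-1)) := by
    rw [show f.derivative.eval (-1) = 1 + β' by simp [f]; ring]
    by_contra h
    have h1 := (mem_max _).1 ((IsLocalRing.mem_maximalIdeal _).2 h)
    have h2 : v (1 + β) = 1 := v.map_one_add_of_lt hβ
    exact h1.ne h2
  obtain ⟨u, hu, hu1⟩ := hK.is_henselian f hf (-1) hf0 hf1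
  have hu2 : v ((u : K) + 1) < 1 := by
    have := (mem_max _).1 hu1
    simpa using this
  refine ⟨u, ?_, hu2, ?_⟩
  · have := v.map_add_eq_of_lt_right (x := (u : K) + 1) (y := -1) (by simpa using hu2)
    simpa using this
  · have h3 : u ^ 3 + u ^ 2 + β' * u + γ' = 0 := by
      simpa [f, IsRoot.def] using hu
    exact congrArg Subtype.val h3

theorem map_one_add_of_one_lt {x : K} (hx : 1 < v x) : v (1 + x) = v x :=
  v.map_add_eq_of_lt_right (by simpa using hx)

end Hensel

section Inequalities

theorem newton_polygon_trichotomy {A B C D : ℝ≥0} (hA : 0 < A)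
    (h : ¬ (B ^ 2 ≤ A ∧ C ≤ 1 ∧ D ^ 2 * A ≤ 1)) :
    (1 < A * D ^ 2 ∧ B < A * D ∧ C < A * D ^ 2) ∨
    (1 < C ∧ B * D < C ^ 2 ∧ A * D ^ 2 < C ^ 3) ∨
    (A < B ^ 2 ∧ C * A < B ^ 2 ∧ D * A ^ 2 < B ^ 3) := by
  rw [not_and_or, not_and_or, not_le, not_le, not_le] at h
  by_cases h3 : B ^ 3 ≤ A ^ 2 * D ∧ C ^ 3 ≤ A * D ^ 2
  · left
    have key : 1 < A * D ^ 2 := by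
      obtain h | h | h := h
      · have : A ^ 3 * 1 < A ^ 3 * (A * D ^ 2) := by
          calc A ^ 3 * 1 = A ^ 3 := mul_one _
            _ < (B ^ 2) ^ 3 := by gcongr
            _ = (B ^ 3) ^ 2 := by ring
            _ ≤ (A ^ 2 * D) ^ 2 := by gcongr; exact h3.1
            _ = _ := by ring
        exact lt_of_mul_lt_mul_left this zero_le
      · exact (one_lt_pow₀ h three_ne_zero).trans_le h3.2
      · rwa [mul_comm]
    refine ⟨key, lt_of_pow_lt_pow_left₀ 3 zero_le ?_, lt_of_pow_lt_pow_left₀ 3 zero_le ?_⟩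
    · have hD : 0 < D := pos_iff_ne_zero.2 (by rintro rfl; simp at key)
      calc B ^ 3 ≤ A ^ 2 * D * 1 := by rw [mul_one]; exact h3.1
        _ < A ^ 2 * D * (A * D ^ 2) := by gcongr
        _ = (A * D) ^ 3 := by ring
    · exact h3.2.trans_lt (lt_self_pow₀ key (by norm_num))
  right
  rw [not_and_or, not_le, not_le] at h3
  obtain h4 | h4 := le_or_gt (B ^ 2) (C * A)
  · left
    have hC3 : A * D ^ 2 < C ^ 3 := by
      obtain h3 | h3 := h3
      · have : A ^ 3 * (A * D ^ 2) < A ^ 3 * C ^ 3 := by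
          calc A ^ 3 * (A * D ^ 2) = (A ^ 2 * D) ^ 2 := by ring
            _ < (B ^ 3) ^ 2 := by gcongr
            _ = (B ^ 2) ^ 3 := by ring
            _ ≤ (C * A) ^ 3 := by gcongr
            _ = _ := by ring
        exact lt_of_mul_lt_mul_left this zero_le
      · exact h3
    have hC : 1 < C := by
      obtain h | h | h := h
      · have : 1 * A < C * A := by rw [one_mul]; exact h.trans_le h4
        exact lt_of_mul_lt_mul_right this zero_le
      · exact h
      · refine lt_of_pow_lt_pow_left₀ 3 zero_le ?_
        rw [one_pow]
        rw [mul_comm] at h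
        exact h.trans hC3
    refine ⟨hC, lt_of_pow_lt_pow_left₀ 2 zero_le ?_, hC3⟩
    have hC0 : 0 < C := zero_lt_one.trans hC
    calc (B * D) ^ 2 = B ^ 2 * D ^ 2 := by ring
      _ ≤ C * A * D ^ 2 := by gcongr
      _ = C * (A * D ^ 2) := by ring
      _ < C * C ^ 3 := by gcongr
      _ = (C ^ 2) ^ 2 := by ring
  · right
    have hB3 : D * A ^ 2 < B ^ 3 := by
      obtain h3 | h3 := h3
      · rwa [mul_comm]
      · refine lt_of_pow_lt_pow_left₀ 2 zero_le ?_
        calc (D * A ^ 2) ^ 2 = A ^ 3 * (A * D ^ 2) := by ring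
          _ < A ^ 3 * C ^ 3 := by gcongr
          _ = (C * A) ^ 3 := by ring
          _ < (B ^ 2) ^ 3 := by gcongr
          _ = _ := by ring
    refine ⟨?_, h4, hB3⟩
    obtain h | h | h := h
    · exact h
    · calc A = 1 * A := (one_mul _).symm
        _ < C * A := by gcongr
        _ < _ := h4
    · refine lt_of_pow_lt_pow_left₀ 3 zero_le ?_
      calc A ^ 3 = 1 * A ^ 3 := (one_mul _).symm
        _ < D ^ 2 * A * A ^ 3 := by gcongr
        _ = (D * A ^ 2) ^ 2 := by ring
        _ < (B ^ 3) ^ 2 := by gcongr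
        _ = _ := by ring

end Inequalities

section RealValued

variable {K : Type*} [Field K] (w : Valuation K ℝ≥0) {φ : K[X]} {z a b c d : K}

theorem map_multiplier_le_one
    (hT : ∀ h, toMap φ (z + h) = z + (h + (a * h ^ 3 + b * h ^ 2 + c * h + d)))
    (hT' : ∀ h, φ.derivative.eval (z + h) = 1 + (3 * a * h ^ 2 + 2 * b * h + c))
    (hb : w b ^ 2 ≤ w a) (hc : w c ≤ 1) (hd : w d ^ 2 * w a ≤ 1) : w (multiplier φ z) ≤ 1 := by
  have hadd {x y : K} (hx : w x ^ 2 * w a ≤ 1) (hy : w y ^ 2 * w a ≤ 1) :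
      w (x + y) ^ 2 * w a ≤ 1 := by
    obtain h | h := le_max_iff.1 (w.map_add x y)
    · exact le_trans (by gcongr) hx
    · exact le_trans (by gcongr) hy
  have horbit (i : ℕ) : ∃ h, (toMap φ)^[i] z = z + h ∧ w h ^ 2 * w a ≤ 1 := by
    induction i with
    | zero => exact ⟨0, by simp, by simp⟩
    | succ i ih =>
      obtain ⟨h, hi, hh⟩ := ih
      refine ⟨_, by rw [Function.iterate_succ_apply', hi, hT],
        hadd hh (hadd (hadd (hadd ?_ ?_) ?_) hd)⟩
      · calc w (a * h ^ 3) ^ 2 * w a = (w h ^ 2 * w a) ^ 3 := by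
              simp only [map_mul, map_pow]; ring
          _ ≤ 1 := pow_le_one₀ zero_le hh
      · calc w (b * h ^ 2) ^ 2 * w a = w b ^ 2 * (w h ^ 4 * w a) := by
              simp only [map_mul, map_pow]; ring
          _ ≤ w a * (w h ^ 4 * w a) := by gcongr
          _ = (w h ^ 2 * w a) ^ 2 := by ring
          _ ≤ 1 := pow_le_one₀ zero_le hh
      · calc w (c * h) ^ 2 * w a = w c ^ 2 * (w h ^ 2 * w a) := by
              simp only [map_mul]; ring
          _ ≤ 1 := mul_le_one₀ (pow_le_one₀ zero_le hc) zero_le hh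
  rw [multiplier, eval_derivative_iterate_comp, map_prod]
  refine Finset.prod_le_one (fun _ _ => zero_le) fun i _ => ?_
  obtain ⟨h, hi, hh⟩ := horbit i
  rw [hi, hT']
  refine w.map_add_le (by simp) (w.map_add_le (w.map_add_le ?_ ?_) hc)
  · calc w (3 * a * h ^ 2) = w 3 * (w h ^ 2 * w a) := by simp only [map_mul, map_pow]; ring
      _ ≤ 1 := mul_le_one₀ (map_ofNat_le_one w 3) zero_le hh
  · have hbh : w b * w h ≤ 1 := by
      refine (pow_le_one_iff_of_nonneg zero_le two_ne_zero).1 ?_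
      calc (w b * w h) ^ 2 = w b ^ 2 * w h ^ 2 := mul_pow _ _ _
        _ ≤ w a * w h ^ 2 := by gcongr
        _ ≤ 1 := by rwa [mul_comm]
    rw [mul_assoc, map_mul, map_mul]
    exact mul_le_one₀ (map_ofNat_le_one w 2) zero_le hbh

theorem notMem_periodicPts_of_escape
    (hT : ∀ h, toMap φ (z + h) = z + (h + (a * h ^ 3 + b * h ^ 2 + c * h + d)))
    (h1 : 1 < w a * w d ^ 2) (hb : w b < w a * w d) (hc : w c < w a * w d ^ 2) :
    z ∉ Function.periodicPts (toMap φ) := by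
  have hd0 : 0 < w d := pos_iff_ne_zero.2 (by intro h; simp [h] at h1)
  have horbit (i : ℕ) : ∃ h, (toMap φ)^[i + 1] z = z + h ∧ w d ≤ w h := by
    induction i with
    | zero => exact ⟨d, by simpa using hT 0, le_rfl⟩
    | succ i ih =>
      obtain ⟨h, hi, hh⟩ := ih
      refine ⟨_, by rw [Function.iterate_succ_apply', hi, hT], ?_⟩
      have hh0 : 0 < w h := hd0.trans_le hh
      have hlin : w h < w (a * h ^ 3) := by
        calc w h = 1 * w h := (one_mul _).symm
          _ < w a * w d ^ 2 * w h := by gcongr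
          _ ≤ w a * w h ^ 2 * w h := by gcongr
          _ = w (a * h ^ 3) := by simp only [map_mul, map_pow]; ring
      have hquad : w (b * h ^ 2) < w (a * h ^ 3) := by
        calc w (b * h ^ 2) = w b * w h ^ 2 := by simp only [map_mul, map_pow]
          _ < w a * w d * w h ^ 2 := by gcongr
          _ ≤ w a * w h * w h ^ 2 := by gcongr
          _ = w (a * h ^ 3) := by simp only [map_mul, map_pow]; ring
      have hlin' : w (c * h) < w (a * h ^ 3) := by
        calc w (c * h) = w c * w h := map_mul _ _ _
          _ < w a * w d ^ 2 * w h := by gcongr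
          _ ≤ w a * w h ^ 2 * w h := by gcongr
          _ = w (a * h ^ 3) := by simp only [map_mul, map_pow]; ring
      have e : h + (a * h ^ 3 + b * h ^ 2 + c * h + d) =
          (h + (b * h ^ 2 + (c * h + d))) + a * h ^ 3 := by ring
      rw [e, w.map_add_eq_of_lt_right
        (w.map_add_lt hlin (w.map_add_lt hquad (w.map_add_lt hlin' (hh.trans_lt hlin))))]
      exact hh.trans hlin.le
  rintro ⟨n, hn, hper⟩
  obtain ⟨h, hi, hh⟩ := horbit (n - 1)
  rw [Nat.sub_add_cancel hn, hper] at hi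
  rw [left_eq_add.1 hi, map_zero] at hh
  exact hd0.not_ge hh

theorem exists_repelling_fixedPt_of_linear_dominant (hK : HenselianLocalRing w.valuationSubring)
    (hT : ∀ h, toMap φ (z + h) = z + (h + (a * h ^ 3 + b * h ^ 2 + c * h + d)))
    (hT' : ∀ h, φ.derivative.eval (z + h) = 1 + (3 * a * h ^ 2 + 2 * b * h + c))
    (hc : 1 < w c) (hb : w b * w d < w c ^ 2) (hd : w a * w d ^ 2 < w c ^ 3) :
    ∃ x, Function.IsFixedPt (toMap φ) x ∧ 1 < w (φ.derivative.eval x) := by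
  have hc0 : c ≠ 0 := by rintro rfl; simp at hc
  have hwc : 0 < w c := zero_lt_one.trans hc
  have hβ : w (b * d / c ^ 2) < 1 := by
    rw [map_div₀, map_mul, map_pow, div_lt_one (by positivity)]; exact hb
  have hγ : w (a * d ^ 2 / c ^ 3) < 1 := by
    rw [map_div₀, map_mul, map_pow, map_pow, div_lt_one (by positivity)]; exact hd
  obtain ⟨u, hu, -, hroot⟩ := exists_root_near_neg_one w hK hβ hγ
  have hu0 : u ≠ 0 := by rintro rfl; simp at hu
  refine ⟨z + d / c / u, ?_, ?_⟩
  · rw [Function.IsFixedPt, hT]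
    have : a * (d / c / u) ^ 3 + b * (d / c / u) ^ 2 + c * (d / c / u) + d = 0 := by
      calc _ = d / u ^ 3 * (u ^ 3 + u ^ 2 + b * d / c ^ 2 * u + a * d ^ 2 / c ^ 3) := by
            field_simp; ring
        _ = 0 := by rw [hroot, mul_zero]
    rw [this, add_zero]
  · have e : 3 * a * (d / c / u) ^ 2 + 2 * b * (d / c / u) + c =
        c * (1 + (3 * (a * d ^ 2 / c ^ 3) / u ^ 2 + 2 * (b * d / c ^ 2) / u)) := by
      field_simp; ring
    have hlt : w (3 * (a * d ^ 2 / c ^ 3) / u ^ 2 + 2 * (b * d / c ^ 2) / u) < 1 := by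
      apply w.map_add_lt
      · rw [map_div₀, map_pow, hu, one_pow, div_one, map_mul]
        exact mul_lt_one_of_nonneg_of_lt_one_right (map_ofNat_le_one w 3) zero_le hγ
      · rw [map_div₀, hu, div_one, map_mul]
        exact mul_lt_one_of_nonneg_of_lt_one_right (map_ofNat_le_one w 2) zero_le hβ
    have hval : w (3 * a * (d / c / u) ^ 2 + 2 * b * (d / c / u) + c) = w c := by
      rw [e, map_mul, w.map_one_add_of_lt hlt, mul_one]
    rw [hT', map_one_add_of_one_lt w (hval ▸ hc), hval]
    exact hc

theorem exists_repelling_fixedPt_of_quadratic_dominant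
    (hK : HenselianLocalRing w.valuationSubring) (ha : a ≠ 0)
    (hT : ∀ h, toMap φ (z + h) = z + (h + (a * h ^ 3 + b * h ^ 2 + c * h + d)))
    (hT' : ∀ h, φ.derivative.eval (z + h) = 1 + (3 * a * h ^ 2 + 2 * b * h + c))
    (hb : w a < w b ^ 2) (hc : w c * w a < w b ^ 2) (hd : w d * w a ^ 2 < w b ^ 3) :
    ∃ x, Function.IsFixedPt (toMap φ) x ∧ 1 < w (φ.derivative.eval x) := by
  have hwa : 0 < w a := by rwa [zero_lt_iff, w.ne_zero_iff]
  have hb0 : b ≠ 0 := by rintro rfl; simp at hb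
  have hwb : 0 < w b := by rwa [zero_lt_iff, w.ne_zero_iff]
  have hβ : w (c * a / b ^ 2) < 1 := by
    rw [map_div₀, map_mul, map_pow, div_lt_one (by positivity)]; exact hc
  have hγ : w (d * a ^ 2 / b ^ 3) < 1 := by
    rw [map_div₀, map_mul, map_pow, map_pow, div_lt_one (by positivity)]; exact hd
  obtain ⟨u, hu, hu1, hroot⟩ := exists_root_near_neg_one w hK hβ hγ
  refine ⟨z + b / a * u, ?_, ?_⟩
  · rw [Function.IsFixedPt, hT]
    have : a * (b / a * u) ^ 3 + b * (b / a * u) ^ 2 + c * (b / a * u) + d = 0 := by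
      calc _ = b ^ 3 / a ^ 2 * (u ^ 3 + u ^ 2 + c * a / b ^ 2 * u + d * a ^ 2 / b ^ 3) := by
            field_simp
        _ = 0 := by rw [hroot, mul_zero]
    rw [this, add_zero]
  · have e : 3 * a * (b / a * u) ^ 2 + 2 * b * (b / a * u) + c =
        b ^ 2 / a * (1 + ((3 * u - 1) * (u + 1) + c * a / b ^ 2)) := by
      field_simp; ring
    have hlt : w ((3 * u - 1) * (u + 1) + c * a / b ^ 2) < 1 := by
      refine w.map_add_lt ?_ hβ
      rw [map_mul]
      refine mul_lt_one_of_nonneg_of_lt_one_right (w.map_sub_le ?_ (by simp)) zero_le hu1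
      rw [map_mul, hu, mul_one]
      exact map_ofNat_le_one w 3
    have hval : w (3 * a * (b / a * u) ^ 2 + 2 * b * (b / a * u) + c) = w b ^ 2 / w a := by
      rw [e, map_mul, w.map_one_add_of_lt hlt, mul_one, map_div₀, map_pow]
    have hgt : 1 < w b ^ 2 / w a := (one_lt_div hwa).2 hb
    rw [hT', map_one_add_of_one_lt w (hval ▸ hgt), hval]
    exact hgt

/-- A cubic polynomial over a henselian field of rank one with a repelling periodic point
has a repelling fixed point. -/
theorem exists_repelling_fixedPt (hK : HenselianLocalRing w.valuationSubring)
    (hφ : φ.natDegree = 3) (hz : z ∈ Function.periodicPts (toMap φ))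
    (hrep : 1 < w (multiplier φ z)) :
    ∃ x, Function.IsFixedPt (toMap φ) x ∧ 1 < w (φ.derivative.eval x) := by
  obtain ⟨a, b, c, d, ha, hT, hT'⟩ := exists_expansion φ hφ z
  have hwa : 0 < w a := by rwa [zero_lt_iff, w.ne_zero_iff]
  by_cases h : w b ^ 2 ≤ w a ∧ w c ≤ 1 ∧ w d ^ 2 * w a ≤ 1
  · exact absurd hrep (map_multiplier_le_one w hT hT' h.1 h.2.1 h.2.2).not_gt
  obtain h | h | h := newton_polygon_trichotomy hwa h
  · exact absurd hz (notMem_periodicPts_of_escape w hT h.1 h.2.1 h.2.2)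
  · exact exists_repelling_fixedPt_of_linear_dominant w hK hT hT' h.1 h.2.1 h.2.2
  · exact exists_repelling_fixedPt_of_quadratic_dominant w hK ha hT hT' h.1 h.2.1 h.2.2

end RealValued

end PolyDynamics

theorem corollary2p3 {K : Type*} [Field K] (v : Valuation K ℤᵐ⁰)
    (hv : Function.Surjective v) (hK : HenselianLocalRing v.valuationSubring)
    (φ : K[X]) (hφ : φ.natDegree = 3)
    (hfix : ∀ z : K, Function.IsFixedPt (PolyDynamics.toMap φ) z →
      ¬ PolyDynamics.IsRepelling v φ z) :
    ∀ z : K, z ∈ Function.periodicPts (PolyDynamics.toMap φ) →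
      ¬ PolyDynamics.IsRepelling v φ z := by
  rintro z hz ⟨-, hrep⟩
  have hmono := WithZeroMulInt.toNNReal_strictMono (e := 2) one_lt_two
  let w : Valuation K NNReal := v.map (WithZeroMulInt.toNNReal two_ne_zero) hmono.monotone
  have hw (x : K) : 1 < w x ↔ 1 < v x := by
    rw [← hmono.lt_iff_lt, map_one]; rfl
  have hsub : w.valuationSubring = v.valuationSubring := by
    ext x
    rw [Valuation.mem_valuationSubring_iff, Valuation.mem_valuationSubring_iff, ← not_lt, hw,
      not_lt]
  obtain ⟨x, hx, hx1⟩ := PolyDynamics.exists_repelling_fixedPt w (hsub ▸ hK) hφ hz ((hw _).2 hrep)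
  refine hfix x hx ⟨Function.mk_mem_periodicPts one_pos hx, ?_⟩
  rw [PolyDynamics.multiplier_of_isFixedPt φ hx]
  exact (hw _).1 hx1
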